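/- Let $\mathcal Y_1,\mathcal Y_2$ be finite alphabets, let $p(y_1,y_2)$ be any joint pmf on $\mathcal Y_1\times\mathcal Y_2$, and let $(Y_{1,j},Y_{2,j})$, $j=1,2,\dots$, be i.i.d. with pmf $p$. All logarithms are taken to a common base $b>1$. Consider the two-encoder CEO problem under logarithmic loss in which the source to be estimated is $X_j=(Y_{1,j},Y_{2,j})$, with alphabet $\mathcal X=\mathcal Y_1\times\mathcal Y_2$. The reproduction alphabet $\hat{\mathcal X}$ is the set of probability distributions on $\mathcal X$, and the distortion is $d(x,\hat x)=\log\frac1{\hat x(x)}$ (equal to $+\infty$ if $\hat x(x)=0$), with $d(x^n,\hat x^n)=\frac1n\sum_{j=1}^n d(x_j,\hat x_j)$. A code of blocklength $n\ge1$ consists of encoders $g_i:\mathcal Y_i^n\to\{1,\dots,M_i\}$, $i=1,2$, and a decoder $\psi:\{1,\dots,M_1\}\times\{1,\dots,M_2\}\to\hat{\mathcal X}^n$. A vector $(R_1,R_2,D)\in\mathbb R^3$ is strict-sense achievable if, for some $n\ge1$ and some such code, $R_i\ge\frac1n\log M_i$ for $i=1,2$ and $D\ge\mathbb E\,d(X^n,\hat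 X^n)$, where $\hat X^n=\psi(g_1(Y_1^n),g_2(Y_2^n))$. Let $\overline{\mathcal{RD}}^{\star}_{CEO}\subseteq\mathbb R^3$ be the closure of the set of strict-sense achievable vectors. Theorem. $\overline{\mathcal{RD}}^{\star}_{CEO}$ consists of exactly the vectors $(R_1,R_2,D)$ with $R_1\ge0$, $R_2\ge0$ that satisfy \begin{align*} R_1&\ge H(Y_1\mid Y_2)-D,\\ R_2&\ge H(Y_2\mid Y_1)-D,\\ R_1+R_2&\ge H(Y_1,Y_2)-D,\\ D&\ge 0, \end{align*} where $H$ denotes (conditional) Shannon entropy under $p$. -/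

import Mathlib

open scoped ENNReal

noncomputable section

namespace CEO

/-- Shannon entropy `H(A) = -∑ p(a) log_b p(a)` of a pmf on a finite alphabet
(with `0 log 0 = 0`). -/
def entropy {A : Type*} [Fintype A] (b : ℝ) (p : PMF A) : ℝ :=
  -∑ a, (p a).toReal * Real.logb b (p a).toReal

/-- Conditional entropy `H(A | C) = -∑ p(a,c) log_b (p(a,c) / p(c))` of a joint pmf of `(A, C)`;
terms with `p(a,c) = 0` vanish, and `p(c) > 0` in all the others. -/
def condEntropy {A C : Type*} [Fintype A] [Fintype C] (b : ℝ) (p : PMF (A × C)) : ℝ :=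
  -∑ z, (p z).toReal * Real.logb b ((p z).toReal / (p.map Prod.snd z.2).toReal)

open Classical in
/-- Logarithmic loss `d(x, q) = log_b (1 / q(x))`, equal to `∞` when `q(x) = 0`. For `1 < b` the
real logarithm below is nonnegative, because `q(x) ≤ 1`. -/
def logLoss {X : Type*} (b : ℝ) (x : X) (q : PMF X) : ℝ≥0∞ :=
  if q x = 0 then ∞ else ENNReal.ofReal (Real.logb b (1 / (q x).toReal))

/-- Distortion between sequences: the average of the symbol-wise logarithmic losses. -/
def seqLogLoss {X : Type*} (b : ℝ) {n : ℕ} (x : Fin n → X) (q : Fin n → PMF X) : ℝ≥0∞ :=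
  (∑ j, logLoss b (x j) (q j)) / (n : ℝ≥0∞)

/-- A two-encoder CEO code of blocklength `n` with message sets of sizes `M₁` and `M₂`.
The decoder outputs a sequence of probability distributions on the alphabet of `X`. -/
structure Code (X Y₁ Y₂ : Type*) (n M₁ M₂ : ℕ) where
  enc₁ : (Fin n → Y₁) → Fin M₁
  enc₂ : (Fin n → Y₂) → Fin M₂
  dec : Fin M₁ → Fin M₂ → (Fin n → PMF X)

/-- Expected distortion `𝔼 d(Xⁿ, X̂ⁿ)` of a code when the triples `(X_j, Y_{1,j}, Y_{2,j})` are
i.i.d. with joint pmf `p`. A sequence of triples is `s`, its probability is `∏ j, p (s j)`. -/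
def Code.expDistortion {X Y₁ Y₂ : Type*} [Fintype X] [Fintype Y₁] [Fintype Y₂] {n M₁ M₂ : ℕ}
    (c : Code X Y₁ Y₂ n M₁ M₂) (b : ℝ) (p : PMF (X × Y₁ × Y₂)) : ℝ≥0∞ :=
  ∑ s : Fin n → X × Y₁ × Y₂,
    (∏ j, p (s j)) *
      seqLogLoss b (fun j => (s j).1)
        (c.dec (c.enc₁ fun j => (s j).2.1) (c.enc₂ fun j => (s j).2.2))

/-- The set of strict-sense achievable vectors `(R₁, R₂, D)`. The distortion constraint is compared
in the extended reals, so it fails for every `D` when the expected distortion is infinite. -/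
def strictRegion {X Y₁ Y₂ : Type*} [Fintype X] [Fintype Y₁] [Fintype Y₂]
    (b : ℝ) (p : PMF (X × Y₁ × Y₂)) : Set (ℝ × ℝ × ℝ) :=
  {v | ∃ n M₁ M₂ : ℕ, 0 < n ∧ ∃ c : Code X Y₁ Y₂ n M₁ M₂,
    Real.logb b M₁ / n ≤ v.1 ∧
    Real.logb b M₂ / n ≤ v.2.1 ∧
    (c.expDistortion b p : EReal) ≤ ((v.2.2 : ℝ) : EReal)}

/-- The achievable region: the closure of the strict-sense achievable region. -/
def region {X Y₁ Y₂ : Type*} [Fintype X] [Fintype Y₁] [Fintype Y₂]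
    (b : ℝ) (p : PMF (X × Y₁ × Y₂)) : Set (ℝ × ℝ × ℝ) :=
  closure (strictRegion b p)

/-- The joint pmf of `(X, Y₁, Y₂)` when `X = (Y₁, Y₂)` and `(Y₁, Y₂)` has pmf `p`. -/
def pairSource {Y₁ Y₂ : Type*} (p : PMF (Y₁ × Y₂)) : PMF ((Y₁ × Y₂) × Y₁ × Y₂) :=
  p.map fun y => (y, y.1, y.2)

end CEO

end

/-! Converse. The inequality `log x ≤ x - 1`, summed over source sequences, compares the i.i.d. law
with the probability the decoder's output gives to the true sequence (`Code.le_totalLoss_add_logb`).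
Entropies of messages never appear. All that is needed is a count: for each fixed message the
product of the output pmfs has total mass one, so summing over sequences costs at most the number of
messages (`sum_prod_le_card`). Weight `1` gives the sum-rate bound. Weighting by the marginal of one
source, whose message is then fixed by its sequence, leaves only the other encoder's messages and
gives the two conditional bounds.

Achievability. The region is closed, convex by time sharing (`convex_region`) and upward closed, so
five points of the polyhedron suffice (`mem_of_extreme_points`): no communication; one source
described losslessly and the other guessed from its conditional law (two points); and the two
Slepian-Wolf corners with zero distortion. The corners allow successive decoding, so one coding
theorem, random binning with side information at the decoder (`exists_sideInfo_code`), covers every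
rate. `mem_region_of_decodable` turns small decoding error into small expected loss, by mixing each
output with a little uniform mass so that a wrong decoding costs only a bounded amount per symbol.
-/

open scoped ENNReal

noncomputable section

namespace CEO

/-! ### Reduction to real-valued losses and unnormalized totals -/

section

variable {Y₁ Y₂ : Type*}

/-- The output of the decoder as a function of the pair of source sequences. -/
def Code.out {X : Type*} {n M₁ M₂ : ℕ} (c : Code X Y₁ Y₂ n M₁ M₂) (z : Fin n → Y₁ × Y₂) :
    Fin n → PMF X :=
  c.dec (c.enc₁ fun j => (z j).1) (c.enc₂ fun j => (z j).2)

/-- The decoder gives positive mass to every source symbol that can occur. -/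
def Code.PosOnSupport {n M₁ M₂ : ℕ} (c : Code (Y₁ × Y₂) Y₁ Y₂ n M₁ M₂) (p : PMF (Y₁ × Y₂)) :
    Prop :=
  ∀ z : Fin n → Y₁ × Y₂, (∀ j, p (z j) ≠ 0) → ∀ j, c.out z j (z j) ≠ 0

/-- The expected logarithmic loss of a code, summed over the block, as a real number. -/
def Code.totalLoss [Fintype Y₁] [Fintype Y₂] {n M₁ M₂ : ℕ}
    (c : Code (Y₁ × Y₂) Y₁ Y₂ n M₁ M₂) (b : ℝ) (p : PMF (Y₁ × Y₂)) : ℝ :=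
  ∑ z : Fin n → Y₁ × Y₂, (∏ j, (p (z j)).toReal) * ∑ j, -Real.logb b (c.out z j (z j)).toReal

theorem pairSource_apply_diag (p : PMF (Y₁ × Y₂)) (y : Y₁ × Y₂) :
    pairSource p (y, y.1, y.2) = p y := by
  classical
  rw [pairSource, PMF.map_apply, tsum_eq_single y]
  · simp
  · rintro y' h
    rw [if_neg]
    intro h'
    exact h (Prod.ext_iff.1 h').1.symm

theorem pairSource_eq_zero (p : PMF (Y₁ × Y₂)) {s : (Y₁ × Y₂) × Y₁ × Y₂}
    (hs : ∀ y : Y₁ × Y₂, s ≠ (y, y.1, y.2)) : pairSource p s = 0 := by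
  classical
  rw [pairSource, PMF.map_apply, ENNReal.tsum_eq_zero]
  exact fun y => if_neg (hs y)

theorem Code.expDistortion_pairSource [Fintype Y₁] [Fintype Y₂] {n M₁ M₂ : ℕ}
    (c : Code (Y₁ × Y₂) Y₁ Y₂ n M₁ M₂) (b : ℝ) (p : PMF (Y₁ × Y₂)) :
    c.expDistortion b (pairSource p) =
      ∑ z : Fin n → Y₁ × Y₂, (∏ j, p (z j)) * seqLogLoss b z (c.out z) := by
  symm
  refine Fintype.sum_of_injective (fun z j => (z j, (z j).1, (z j).2)) ?_ _ _ ?_ ?_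
  · intro z z' h
    funext j
    exact (Prod.ext_iff.1 (congrFun h j)).1
  · intro s hs
    have : ∃ j, ∀ y : Y₁ × Y₂, s j ≠ (y, y.1, y.2) := by
      by_contra! h
      choose z hz using h
      exact hs ⟨z, funext fun j => (hz j).symm⟩
    obtain ⟨j, hj⟩ := this
    rw [Finset.prod_eq_zero (Finset.mem_univ j) (pairSource_eq_zero p hj), zero_mul]
  · intro z
    simp only [pairSource_apply_diag]
    rfl

theorem toReal_le_one {A : Type*} (q : PMF A) (a : A) : (q a).toReal ≤ 1 :=
  ENNReal.toReal_mono ENNReal.one_ne_top (q.coe_le_one a) |>.trans_eq ENNReal.toReal_one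

theorem neg_logb_nonneg {b : ℝ} (hb : 1 < b) {x : ℝ} (h0 : 0 ≤ x) (h1 : x ≤ 1) :
    0 ≤ -Real.logb b x :=
  neg_nonneg.2 (Real.logb_nonpos hb h0 h1)

/-- An infinite loss on a sequence of positive probability already makes the whole finite sum
infinite. -/
theorem Code.posOnSupport_of_expDistortion_ne_top [Fintype Y₁] [Fintype Y₂] {n M₁ M₂ : ℕ}
    (c : Code (Y₁ × Y₂) Y₁ Y₂ n M₁ M₂) {b : ℝ} {p : PMF (Y₁ × Y₂)}
    (h : c.expDistortion b (pairSource p) ≠ ∞) : c.PosOnSupport p := by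
  intro z hz j hj
  apply h
  rw [c.expDistortion_pairSource, ENNReal.sum_eq_top]
  refine ⟨z, Finset.mem_univ _, ?_⟩
  have h1 : seqLogLoss b z (c.out z) = ∞ := by
    rw [seqLogLoss, ENNReal.sum_eq_top.2 ⟨j, Finset.mem_univ _, by simp [logLoss, hj]⟩]
    exact ENNReal.top_div_of_ne_top (ENNReal.natCast_ne_top n)
  rw [h1, ENNReal.mul_top]
  exact Finset.prod_ne_zero_iff.2 fun j _ => hz j

theorem Code.totalLoss_nonneg [Fintype Y₁] [Fintype Y₂] {n M₁ M₂ : ℕ}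
    (c : Code (Y₁ × Y₂) Y₁ Y₂ n M₁ M₂) {b : ℝ} (hb : 1 < b) (p : PMF (Y₁ × Y₂)) :
    0 ≤ c.totalLoss b p :=
  Finset.sum_nonneg fun _ _ => mul_nonneg (Finset.prod_nonneg fun _ _ => ENNReal.toReal_nonneg)
    (Finset.sum_nonneg fun _ _ =>
      neg_logb_nonneg hb ENNReal.toReal_nonneg (toReal_le_one _ _))

theorem Code.expDistortion_eq_ofReal [Fintype Y₁] [Fintype Y₂] {n M₁ M₂ : ℕ} (hn : 0 < n)
    (c : Code (Y₁ × Y₂) Y₁ Y₂ n M₁ M₂) {b : ℝ} (hb : 1 < b) {p : PMF (Y₁ × Y₂)}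
    (hc : c.PosOnSupport p) :
    c.expDistortion b (pairSource p) = ENNReal.ofReal (c.totalLoss b p / n) := by
  have hnn : ∀ z : Fin n → Y₁ × Y₂, ∀ j, 0 ≤ -Real.logb b (c.out z j (z j)).toReal :=
    fun z j => neg_logb_nonneg hb ENNReal.toReal_nonneg (toReal_le_one _ _)
  have hpn : ∀ z : Fin n → Y₁ × Y₂, 0 ≤ ∏ j, (p (z j)).toReal :=
    fun z => Finset.prod_nonneg fun _ _ => ENNReal.toReal_nonneg
  rw [c.expDistortion_pairSource, Code.totalLoss, Finset.sum_div, ENNReal.ofReal_sum_of_nonneg]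
  · refine Finset.sum_congr rfl fun z _ => ?_
    by_cases hz : ∀ j, p (z j) ≠ 0
    · rw [mul_div_assoc, ENNReal.ofReal_mul (hpn z), ENNReal.ofReal_prod_of_nonneg
        (fun _ _ => ENNReal.toReal_nonneg), seqLogLoss,
        ENNReal.ofReal_div_of_pos (by exact_mod_cast hn), ENNReal.ofReal_natCast,
        ENNReal.ofReal_sum_of_nonneg (fun j _ => hnn z j)]
      congr 1
      · exact Finset.prod_congr rfl fun j _ => (ENNReal.ofReal_toReal (p.apply_ne_top _)).symm
      · congr 1
        refine Finset.sum_congr rfl fun j _ => ?_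
        rw [logLoss, if_neg (hc z hz j), one_div, Real.logb_inv]
    -- A sequence of zero probability contributes `0` on both sides, even if its loss is infinite,
    -- because `0 * ∞ = 0`.
    · push Not at hz
      obtain ⟨j, hj⟩ := hz
      rw [Finset.prod_eq_zero (Finset.mem_univ j) hj,
        Finset.prod_eq_zero (Finset.mem_univ j) (by rw [hj]; rfl)]
      simp
  · exact fun z _ => div_nonneg (mul_nonneg (hpn z) (Finset.sum_nonneg fun j _ => hnn z j))
      (Nat.cast_nonneg n)

/-- The vector `v` bounds the total rates and the total expected loss of a code of
blocklength `n`. -/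
def Achieves [Fintype Y₁] [Fintype Y₂] (b : ℝ) (p : PMF (Y₁ × Y₂)) (n : ℕ) (v : ℝ × ℝ × ℝ) :
    Prop :=
  ∃ M₁ M₂ : ℕ, ∃ c : Code (Y₁ × Y₂) Y₁ Y₂ n M₁ M₂, Real.logb b M₁ ≤ v.1 ∧
    Real.logb b M₂ ≤ v.2.1 ∧ c.PosOnSupport p ∧ c.totalLoss b p ≤ v.2.2

/-- Multiplying out `1 / n` leaves total rates and total loss, which add under concatenation of
codes and enter the converse directly. -/
theorem mem_strictRegion_iff [Fintype Y₁] [Fintype Y₂] {b : ℝ} (hb : 1 < b)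
    {p : PMF (Y₁ × Y₂)} {v : ℝ × ℝ × ℝ} :
    v ∈ strictRegion b (pairSource p) ↔ ∃ n : ℕ, 0 < n ∧ Achieves b p n ((n : ℝ) • v) := by
  constructor
  · rintro ⟨n, M₁, M₂, hn, c, h1, h2, h3⟩
    have hn' : (0 : ℝ) < n := by exact_mod_cast hn
    have hc : c.PosOnSupport p := by
      apply c.posOnSupport_of_expDistortion_ne_top (b := b)
      intro h
      rw [h, EReal.coe_ennreal_top, top_le_iff] at h3
      exact EReal.coe_ne_top _ h3
    refine ⟨n, hn, M₁, M₂, c, (div_le_iff₀' hn').1 h1, (div_le_iff₀' hn').1 h2, hc, ?_⟩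
    rw [c.expDistortion_eq_ofReal hn hb hc, EReal.coe_ennreal_ofReal, EReal.coe_le_coe_iff] at h3
    exact (div_le_iff₀' hn').1 ((le_max_left _ _).trans h3)
  · rintro ⟨n, hn, M₁, M₂, c, h1, h2, hc, h3⟩
    have hn' : (0 : ℝ) < n := by exact_mod_cast hn
    refine ⟨n, M₁, M₂, hn, c, (div_le_iff₀' hn').2 h1, (div_le_iff₀' hn').2 h2, ?_⟩
    rw [c.expDistortion_eq_ofReal hn hb hc, EReal.coe_ennreal_ofReal, EReal.coe_le_coe_iff]
    exact max_le ((div_le_iff₀' hn').2 h3)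
      ((div_nonneg (c.totalLoss_nonneg hb p) hn'.le).trans ((div_le_iff₀' hn').2 h3))

end

/-! ### Converse: Gibbs' inequality and counting messages -/

section

theorem prod_sum_eq_sum_prod {A : Type*} [Fintype A] {n : ℕ} (f : Fin n → A → ℝ) :
    ∏ j, ∑ a, f j a = ∑ s : Fin n → A, ∏ j, f j (s j) := by
  classical
  rw [Finset.prod_univ_sum, Fintype.piFinset_univ]

theorem sum_prod_eq_one {A : Type*} [Fintype A] {P : A → ℝ} (hP : ∑ a, P a = 1) (n : ℕ) :
    ∑ s : Fin n → A, ∏ j, P (s j) = 1 := by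
  rw [← prod_sum_eq_sum_prod (fun _ => P)]
  simp [hP]

theorem sum_prod_mul_sum {A : Type*} [Fintype A] {P : A → ℝ} (hP : ∑ a, P a = 1)
    (L : A → ℝ) (n : ℕ) :
    ∑ s : Fin n → A, (∏ j, P (s j)) * ∑ j, L (s j) = n * ∑ a, P a * L a := by
  have key : ∀ j : Fin n, ∑ s : Fin n → A, (∏ i, P (s i)) * L (s j) = ∑ a, P a * L a := by
    intro j
    -- The factor `L` is inserted at coordinate `j` only; the other coordinates sum to one.
    have h := prod_sum_eq_sum_prod (fun i a => P a * if i = j then L a else 1)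
    simp only [Finset.prod_mul_distrib, Finset.prod_ite_eq', Finset.mem_univ, if_true] at h
    rw [← h, Finset.prod_eq_single j]
    · simp
    · intro i _ hi
      simp [hi, hP]
    · simp
  simp only [Finset.mul_sum]
  rw [Finset.sum_comm, Finset.sum_congr rfl fun j _ => key j]
  simp [Finset.mul_sum]

/-- The term at the actual message `e s` is at most the sum over all messages `m`. For fixed `m` the
sum over sequences factorizes into coordinate sums, each at most one. -/
theorem sum_prod_le_card {A M : Type*} [Fintype A] [Fintype M] {n : ℕ} (e : (Fin n → A) → M)
    (G : M → Fin n → A → ℝ) (h0 : ∀ m j a, 0 ≤ G m j a) (h1 : ∀ m j, ∑ a, G m j a ≤ 1) :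
    ∑ s : Fin n → A, ∏ j, G (e s) j (s j) ≤ Fintype.card M := by
  calc ∑ s : Fin n → A, ∏ j, G (e s) j (s j)
      ≤ ∑ s : Fin n → A, ∑ m, ∏ j, G m j (s j) :=
        Finset.sum_le_sum fun s _ => Finset.single_le_sum
          (f := fun m => ∏ j, G m j (s j))
          (fun m _ => Finset.prod_nonneg fun j _ => h0 m j (s j)) (Finset.mem_univ (e s))
    _ = ∑ m, ∏ j, ∑ a, G m j a := by
        rw [Finset.sum_comm]
        exact Finset.sum_congr rfl fun m _ => (prod_sum_eq_sum_prod (G m)).symm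
    _ ≤ ∑ _m : M, (1 : ℝ) := Finset.sum_le_sum fun m _ =>
        Finset.prod_le_one (fun j _ => Finset.sum_nonneg fun a _ => h0 m j a) fun j _ => h1 m j
    _ = Fintype.card M := by simp

theorem sum_toReal {A : Type*} [Fintype A] (q : PMF A) : ∑ a, (q a).toReal = 1 := by
  rw [← ENNReal.toReal_sum fun a _ => q.apply_ne_top a, ← tsum_fintype (L := .unconditional A),
    q.tsum_coe, ENNReal.toReal_one]

theorem toReal_pos {A : Type*} {q : PMF A} {a : A} (h : q a ≠ 0) : 0 < (q a).toReal :=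
  ENNReal.toReal_pos h (q.apply_ne_top a)

variable {Y₁ Y₂ : Type*} [Fintype Y₁] [Fintype Y₂]

/-- Gibbs' inequality for the output of a code, relative to a product weight `∏ r`. -/
theorem Code.le_totalLoss_add_logb {n M₁ M₂ : ℕ} (c : Code (Y₁ × Y₂) Y₁ Y₂ n M₁ M₂) {b : ℝ}
    (hb : 1 < b) {p : PMF (Y₁ × Y₂)} (hc : c.PosOnSupport p) {r : Y₁ × Y₂ → ℝ}
    (hr0 : ∀ z, 0 ≤ r z) (hr : ∀ z, p z ≠ 0 → 0 < r z) {K : ℝ} (hK : 0 < K)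
    (hsum : ∑ z : Fin n → Y₁ × Y₂, (∏ j, r (z j)) * ∏ j, (c.out z j (z j)).toReal ≤ K) :
    n * -∑ z, (p z).toReal * Real.logb b ((p z).toReal / r z) ≤
      c.totalLoss b p + Real.logb b K := by
  have hlb : 0 < Real.log b := Real.log_pos hb
  have hmean := sum_prod_mul_sum (sum_toReal p)
    (fun z => -Real.logb b ((p z).toReal / r z)) n
  have hone := sum_prod_eq_one (sum_toReal p) n
  -- With `P`, `Q`, `R` the products of `p`, of the output masses and of `r`, this is `P * log (R *
  -- Q / (K * P)) ≤ R * Q / K - P`, divided by `log b`. Summed over `z`, the right side is at most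
  -- `0` by `hsum`.
  have hterm : ∀ z : Fin n → Y₁ × Y₂,
      (∏ j, (p (z j)).toReal) * ∑ j, -Real.logb b ((p (z j)).toReal / r (z j))
        - (∏ j, (p (z j)).toReal) * ∑ j, -Real.logb b (c.out z j (z j)).toReal
        - (∏ j, (p (z j)).toReal) * Real.logb b K ≤
      (((∏ j, r (z j)) * ∏ j, (c.out z j (z j)).toReal) / K - ∏ j, (p (z j)).toReal)
        / Real.log b := by
    intro z
    by_cases hz : ∀ j, p (z j) ≠ 0
    · have hp : ∀ j, 0 < (p (z j)).toReal := fun j => toReal_pos (hz j)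
      have hq : ∀ j, 0 < (c.out z j (z j)).toReal := fun j => toReal_pos (hc z hz j)
      have hr' : ∀ j, 0 < r (z j) := fun j => hr _ (hz j)
      have hP := Finset.prod_pos fun j (_ : j ∈ Finset.univ) => hp j
      have hQ := Finset.prod_pos fun j (_ : j ∈ Finset.univ) => hq j
      have hR := Finset.prod_pos fun j (_ : j ∈ Finset.univ) => hr' j
      have e1 : ∑ j, -Real.logb b ((p (z j)).toReal / r (z j)) =
          (Real.log (∏ j, r (z j)) - Real.log (∏ j, (p (z j)).toReal)) / Real.log b := by
        rw [Real.log_prod fun j _ => (hr' j).ne', Real.log_prod fun j _ => (hp j).ne',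
          ← Finset.sum_sub_distrib, Finset.sum_div]
        refine Finset.sum_congr rfl fun j _ => ?_
        rw [Real.logb, Real.log_div (hp j).ne' (hr' j).ne']
        ring
      have e2 : ∑ j, -Real.logb b (c.out z j (z j)).toReal =
          -Real.log (∏ j, (c.out z j (z j)).toReal) / Real.log b := by
        rw [Real.log_prod fun j _ => (hq j).ne', ← Finset.sum_neg_distrib, Finset.sum_div]
        refine Finset.sum_congr rfl fun j _ => ?_
        rw [Real.logb]
        ring
      rw [e1, e2, Real.logb]
      generalize (∏ j, (p (z j)).toReal) = P at *
      generalize (∏ j, (c.out z j (z j)).toReal) = Q at *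
      generalize (∏ j, r (z j)) = R at *
      have h := Real.log_le_sub_one_of_pos (show 0 < R * Q / (K * P) by positivity)
      rw [Real.log_div (by positivity) (by positivity), Real.log_mul hR.ne' hQ.ne',
        Real.log_mul hK.ne' hP.ne'] at h
      have h2 := mul_le_mul_of_nonneg_left h hP.le
      have h3 : P * (R * Q / (K * P) - 1) = R * Q / K - P := by field_simp
      rw [h3] at h2
      calc _ = P * (Real.log R + Real.log Q - (Real.log K + Real.log P)) / Real.log b := by ring
        _ ≤ _ := by gcongr
    · push Not at hz
      obtain ⟨j, hj⟩ := hz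
      rw [Finset.prod_eq_zero (Finset.mem_univ j)
        (show (p (z j)).toReal = 0 by rw [hj]; rfl)]
      simp only [zero_mul, sub_zero]
      exact div_nonneg (div_nonneg (mul_nonneg (Finset.prod_nonneg fun _ _ => hr0 _)
        (Finset.prod_nonneg fun _ _ => ENNReal.toReal_nonneg)) hK.le) hlb.le
  have hs := Finset.sum_le_sum fun z (_ : z ∈ Finset.univ) => hterm z
  rw [Finset.sum_sub_distrib, Finset.sum_sub_distrib, hmean, ← Finset.sum_mul, hone,
    ← Finset.sum_div, Finset.sum_sub_distrib, hone, ← Finset.sum_div] at hs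
  have h4 : ((∑ z : Fin n → Y₁ × Y₂, (∏ j, r (z j)) * ∏ j, (c.out z j (z j)).toReal) / K - 1)
      / Real.log b ≤ 0 :=
    div_nonpos_of_nonpos_of_nonneg (sub_nonpos.2 ((div_le_one hK).2 hsum)) hlb.le
  simp only [mul_neg, Finset.sum_neg_distrib] at hs
  rw [Code.totalLoss]
  simp only [mul_neg, Finset.sum_neg_distrib] at hs ⊢
  linarith

theorem map_fst_apply_toReal (p : PMF (Y₁ × Y₂)) (y : Y₁) :
    (p.map Prod.fst y).toReal = ∑ y₂, (p (y, y₂)).toReal := by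
  classical
  rw [PMF.map_apply, tsum_fintype, Fintype.sum_prod_type, Finset.sum_eq_single y]
  · simp only [if_true]
    exact ENNReal.toReal_sum fun a _ => p.apply_ne_top _
  · intro y' _ h
    simp [h.symm]
  · simp

theorem map_snd_apply_toReal (p : PMF (Y₁ × Y₂)) (y : Y₂) :
    (p.map Prod.snd y).toReal = ∑ y₁, (p (y₁, y)).toReal := by
  classical
  rw [PMF.map_apply, tsum_fintype, Fintype.sum_prod_type_right, Finset.sum_eq_single y]
  · simp only [if_true]
    exact ENNReal.toReal_sum fun a _ => p.apply_ne_top _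
  · intro y' _ h
    simp [h.symm]
  · simp

theorem map_apply_ne_zero {A C : Type*} {p : PMF A} (f : A → C) {a : A} (h : p a ≠ 0) :
    p.map f (f a) ≠ 0 :=
  (PMF.mem_support_iff _ _).1 ((PMF.mem_support_map_iff f p _).2 ⟨a, h, rfl⟩)

theorem map_swap_apply {A C : Type*} (p : PMF (A × C)) (z : C × A) : p.map Prod.swap z = p z.swap := by
  classical
  rw [PMF.map_apply, tsum_eq_single z.swap]
  · simp
  · intro y h
    rw [if_neg]
    rintro rfl
    exact h (by simp)

theorem condEntropy_swap (b : ℝ) (p : PMF (Y₁ × Y₂)) :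
    condEntropy b (p.map Prod.swap) =
      -∑ z, (p z).toReal * Real.logb b ((p z).toReal / (p.map Prod.fst z.1).toReal) := by
  rw [condEntropy, ← (Equiv.prodComm Y₁ Y₂).sum_comp, PMF.map_comp]
  simp only [map_swap_apply]
  rfl

/-- A pmf has nonempty support, so each encoder has an input and hence a value. This makes the
logarithms of the message counts meaningful. -/
theorem Code.card_pos {X A C : Type*} {n M₁ M₂ : ℕ} (c : Code X A C n M₁ M₂) (p : PMF (A × C)) :
    0 < M₁ ∧ 0 < M₂ := by
  obtain ⟨y, -⟩ := p.support_nonempty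
  exact ⟨(c.enc₁ fun _ => y.1).pos, (c.enc₂ fun _ => y.2).pos⟩

/-- Gibbs' inequality with `r = 1`, counting pairs of messages. -/
theorem Code.entropy_le {n M₁ M₂ : ℕ} (c : Code (Y₁ × Y₂) Y₁ Y₂ n M₁ M₂) {b : ℝ}
    (hb : 1 < b) {p : PMF (Y₁ × Y₂)} (hc : c.PosOnSupport p) :
    n * entropy b p ≤ c.totalLoss b p + (Real.logb b M₁ + Real.logb b M₂) := by
  obtain ⟨h1, h2⟩ := c.card_pos p
  have h1' : (0 : ℝ) < M₁ := by exact_mod_cast h1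
  have h2' : (0 : ℝ) < M₂ := by exact_mod_cast h2
  rw [← Real.logb_mul h1'.ne' h2'.ne']
  have h := c.le_totalLoss_add_logb hb hc (r := fun _ => 1) (fun _ => zero_le_one)
    (fun _ _ => one_pos) (mul_pos h1' h2') ?_
  · simpa [entropy] using h
  · have := sum_prod_le_card (M := Fin M₁ × Fin M₂)
      (fun z : Fin n → Y₁ × Y₂ => (c.enc₁ fun j => (z j).1, c.enc₂ fun j => (z j).2))
      (fun m j a => (c.dec m.1 m.2 j a).toReal) (fun _ _ _ => ENNReal.toReal_nonneg)
      (fun m j => (sum_toReal _).le)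
    simpa [Code.out] using this

/-- Gibbs' inequality with `r` the law of the second source. Once `y₂` is fixed, the second message
is too, and the section `a ↦ q (a, y₂ j)` of an output pmf has mass at most one, so the sum over
`y₁` is at most `M₁`; averaging over `y₂` keeps this bound. -/
theorem Code.condEntropy_le {n M₁ M₂ : ℕ} (c : Code (Y₁ × Y₂) Y₁ Y₂ n M₁ M₂) {b : ℝ}
    (hb : 1 < b) {p : PMF (Y₁ × Y₂)} (hc : c.PosOnSupport p) :
    n * condEntropy b p ≤ c.totalLoss b p + Real.logb b M₁ := by
  have h1' : (0 : ℝ) < M₁ := by exact_mod_cast (c.card_pos p).1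
  refine c.le_totalLoss_add_logb hb hc (r := fun z => (p.map Prod.snd z.2).toReal)
    (fun _ => ENNReal.toReal_nonneg) (fun z hz => toReal_pos (map_apply_ne_zero _ hz)) h1' ?_
  rw [← (Equiv.arrowProdEquivProdArrow (Fin n) (fun _ => Y₁) (fun _ => Y₂)).symm.sum_comp,
    Fintype.sum_prod_type_right]
  calc _ ≤ ∑ y₂ : Fin n → Y₂, (∏ j, (p.map Prod.snd (y₂ j)).toReal) * M₁ := by
        refine Finset.sum_le_sum fun y₂ _ => ?_
        have := sum_prod_le_card (M := Fin M₁) c.enc₁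
          (fun m j a => (c.dec m (c.enc₂ y₂) j (a, y₂ j)).toReal)
          (fun _ _ _ => ENNReal.toReal_nonneg) (fun m j => ?_)
        · rw [Fintype.card_fin] at this
          refine le_trans (le_of_eq ?_) (mul_le_mul_of_nonneg_left this
            (Finset.prod_nonneg fun _ _ => ENNReal.toReal_nonneg))
          rw [Finset.mul_sum]
          rfl
        · rw [← map_snd_apply_toReal]
          exact toReal_le_one _ _
    _ = M₁ := by rw [← Finset.sum_mul, sum_prod_eq_one (sum_toReal _), one_mul]

theorem Code.condEntropy_swap_le {n M₁ M₂ : ℕ} (c : Code (Y₁ × Y₂) Y₁ Y₂ n M₁ M₂) {b : ℝ}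
    (hb : 1 < b) {p : PMF (Y₁ × Y₂)} (hc : c.PosOnSupport p) :
    n * condEntropy b (p.map Prod.swap) ≤ c.totalLoss b p + Real.logb b M₂ := by
  have h2' : (0 : ℝ) < M₂ := by exact_mod_cast (c.card_pos p).2
  rw [condEntropy_swap]
  refine c.le_totalLoss_add_logb hb hc (r := fun z => (p.map Prod.fst z.1).toReal)
    (fun _ => ENNReal.toReal_nonneg) (fun z hz => toReal_pos (map_apply_ne_zero _ hz)) h2' ?_
  rw [← (Equiv.arrowProdEquivProdArrow (Fin n) (fun _ => Y₁) (fun _ => Y₂)).symm.sum_comp,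
    Fintype.sum_prod_type]
  calc _ ≤ ∑ y₁ : Fin n → Y₁, (∏ j, (p.map Prod.fst (y₁ j)).toReal) * M₂ := by
        refine Finset.sum_le_sum fun y₁ _ => ?_
        have := sum_prod_le_card (M := Fin M₂) c.enc₂
          (fun m j a => (c.dec (c.enc₁ y₁) m j (y₁ j, a)).toReal)
          (fun _ _ _ => ENNReal.toReal_nonneg) (fun m j => ?_)
        · rw [Fintype.card_fin] at this
          refine le_trans (le_of_eq ?_) (mul_le_mul_of_nonneg_left this
            (Finset.prod_nonneg fun _ _ => ENNReal.toReal_nonneg))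
          rw [Finset.mul_sum]
          rfl
        · rw [← map_fst_apply_toReal]
          exact toReal_le_one _ _
    _ = M₂ := by rw [← Finset.sum_mul, sum_prod_eq_one (sum_toReal _), one_mul]

/-- The polyhedron described by the rate-distortion inequalities. -/
def outerRegion (b : ℝ) (p : PMF (Y₁ × Y₂)) : Set (ℝ × ℝ × ℝ) :=
  {v | 0 ≤ v.1 ∧ 0 ≤ v.2.1 ∧ condEntropy b p - v.2.2 ≤ v.1 ∧
    condEntropy b (p.map Prod.swap) - v.2.2 ≤ v.2.1 ∧ entropy b p - v.2.2 ≤ v.1 + v.2.1 ∧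
    0 ≤ v.2.2}

theorem isClosed_outerRegion (b : ℝ) (p : PMF (Y₁ × Y₂)) : IsClosed (outerRegion b p) := by
  simp only [outerRegion, Set.ofPred_and]
  refine (isClosed_le ?_ ?_).inter <| (isClosed_le ?_ ?_).inter <| (isClosed_le ?_ ?_).inter <|
    (isClosed_le ?_ ?_).inter <| (isClosed_le ?_ ?_).inter (isClosed_le ?_ ?_) <;> fun_prop

theorem region_subset_outerRegion {b : ℝ} (hb : 1 < b) (p : PMF (Y₁ × Y₂)) :
    region b (pairSource p) ⊆ outerRegion b p := by
  refine closure_minimal ?_ (isClosed_outerRegion b p)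
  intro v hv
  obtain ⟨n, hn, M₁, M₂, c, h1, h2, hc, h3⟩ := (mem_strictRegion_iff hb).1 hv
  have hn' : (0 : ℝ) < n := by exact_mod_cast hn
  obtain ⟨hM1, hM2⟩ := c.card_pos p
  have l1 : 0 ≤ Real.logb b M₁ := Real.logb_nonneg hb (by exact_mod_cast hM1)
  have l2 : 0 ≤ Real.logb b M₂ := Real.logb_nonneg hb (by exact_mod_cast hM2)
  have l3 := c.totalLoss_nonneg hb p
  have e1 := c.condEntropy_le hb hc
  have e2 := c.condEntropy_swap_le hb hc
  have e3 := c.entropy_le hb hc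
  simp only [Prod.smul_fst, Prod.smul_snd, smul_eq_mul] at h1 h2 h3
  refine ⟨?_, ?_, ?_, ?_, ?_, ?_⟩ <;> refine le_of_mul_le_mul_left ?_ hn' <;> linarith

end

/-! ### Time sharing and the geometry of the polyhedron -/

section

/-- Two codes used one after the other. -/
def Code.append {X Y₁ Y₂ : Type*} {n n' M₁ M₂ M₁' M₂' : ℕ} (c : Code X Y₁ Y₂ n M₁ M₂)
    (c' : Code X Y₁ Y₂ n' M₁' M₂') : Code X Y₁ Y₂ (n + n') (M₁ * M₁') (M₂ * M₂') where
  enc₁ y := finProdFinEquiv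
    (c.enc₁ fun i => y (Fin.castAdd n' i), c'.enc₁ fun i => y (Fin.natAdd n i))
  enc₂ y := finProdFinEquiv
    (c.enc₂ fun i => y (Fin.castAdd n' i), c'.enc₂ fun i => y (Fin.natAdd n i))
  dec m₁ m₂ := Fin.append
    (c.dec (finProdFinEquiv.symm m₁).1 (finProdFinEquiv.symm m₂).1)
    (c'.dec (finProdFinEquiv.symm m₁).2 (finProdFinEquiv.symm m₂).2)

theorem Code.out_append {X Y₁ Y₂ : Type*} {n n' M₁ M₂ M₁' M₂' : ℕ} (c : Code X Y₁ Y₂ n M₁ M₂)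
    (c' : Code X Y₁ Y₂ n' M₁' M₂') (z : Fin (n + n') → Y₁ × Y₂) :
    (c.append c').out z = Fin.append (c.out fun i => z (Fin.castAdd n' i))
      (c'.out fun i => z (Fin.natAdd n i)) := by
  simp only [Code.out, Code.append, Equiv.symm_apply_apply]

theorem Code.PosOnSupport.append {Y₁ Y₂ : Type*} {n n' M₁ M₂ M₁' M₂' : ℕ}
    {c : Code (Y₁ × Y₂) Y₁ Y₂ n M₁ M₂} {c' : Code (Y₁ × Y₂) Y₁ Y₂ n' M₁' M₂'}
    {p : PMF (Y₁ × Y₂)} (h : c.PosOnSupport p) (h' : c'.PosOnSupport p) :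
    (c.append c').PosOnSupport p := by
  intro z hz j
  rw [Code.out_append]
  refine Fin.addCases (fun i => ?_) (fun i => ?_) j
  · rw [Fin.append_left]
    exact h _ (fun i => hz _) i
  · rw [Fin.append_right]
    exact h' _ (fun i => hz _) i

variable {Y₁ Y₂ : Type*} [Fintype Y₁] [Fintype Y₂]

/-- The two blocks are independent, so in each half of the loss the other block's probabilities sum
to one. -/
theorem Code.totalLoss_append {n n' M₁ M₂ M₁' M₂' : ℕ}
    (c : Code (Y₁ × Y₂) Y₁ Y₂ n M₁ M₂) (c' : Code (Y₁ × Y₂) Y₁ Y₂ n' M₁' M₂') (b : ℝ)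
    (p : PMF (Y₁ × Y₂)) :
    (c.append c').totalLoss b p = c.totalLoss b p + c'.totalLoss b p := by
  have h1 := sum_prod_eq_one (sum_toReal p) n
  have h2 := sum_prod_eq_one (sum_toReal p) n'
  rw [Code.totalLoss, ← (Fin.appendEquiv n n').sum_comp, Fintype.sum_prod_type]
  simp only [Fin.appendEquiv_apply, Code.out_append, Fin.prod_univ_add, Fin.sum_univ_add,
    Fin.append_left, Fin.append_right, mul_add, Finset.sum_add_distrib]
  congr 1
  · rw [Code.totalLoss]
    refine Finset.sum_congr rfl fun z _ => ?_
    rw [← Finset.sum_mul, ← Finset.mul_sum, h2, mul_one]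
  · rw [Finset.sum_comm, Code.totalLoss]
    refine Finset.sum_congr rfl fun z _ => ?_
    rw [← Finset.sum_mul, ← Finset.sum_mul, h1, one_mul]

theorem Achieves.add {b : ℝ} {p : PMF (Y₁ × Y₂)} {n n' : ℕ} {v v' : ℝ × ℝ × ℝ}
    (h : Achieves b p n v) (h' : Achieves b p n' v') : Achieves b p (n + n') (v + v') := by
  obtain ⟨M₁, M₂, c, h1, h2, hc, h3⟩ := h
  obtain ⟨M₁', M₂', c', h1', h2', hc', h3'⟩ := h'
  obtain ⟨a1, a2⟩ := c.card_pos p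
  obtain ⟨a1', a2'⟩ := c'.card_pos p
  refine ⟨_, _, c.append c', ?_, ?_, hc.append hc', ?_⟩
  · rw [Nat.cast_mul, Real.logb_mul (by positivity) (by positivity)]
    exact add_le_add h1 h1'
  · rw [Nat.cast_mul, Real.logb_mul (by positivity) (by positivity)]
    exact add_le_add h2 h2'
  · rw [c.totalLoss_append c']
    exact add_le_add h3 h3'

theorem achieves_zero (b : ℝ) (p : PMF (Y₁ × Y₂)) :
    Achieves b p 0 0 := by
  refine ⟨1, 1, ⟨fun _ => 0, fun _ => 0, fun _ _ => Fin.elim0⟩, ?_, ?_, ?_, ?_⟩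
  · simp
  · simp
  · exact fun _ _ j => j.elim0
  · simp [Code.totalLoss]

theorem Achieves.nsmul {b : ℝ} {p : PMF (Y₁ × Y₂)} {n : ℕ} {v : ℝ × ℝ × ℝ}
    (h : Achieves b p n v) (k : ℕ) : Achieves b p (k * n) ((k : ℝ) • v) := by
  induction k with
  | zero => simpa using achieves_zero b p
  | succ k ih =>
    rw [Nat.succ_mul, Nat.cast_succ, add_smul, one_smul]
    exact ih.add h

theorem strictRegion_rat_convex {b : ℝ} (hb : 1 < b) {p : PMF (Y₁ × Y₂)} {v w : ℝ × ℝ × ℝ}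
    (hv : v ∈ strictRegion b (pairSource p)) (hw : w ∈ strictRegion b (pairSource p))
    {k m : ℕ} (hm : 0 < m) (hk : k ≤ m) :
    ((k : ℝ) / m) • v + (1 - (k : ℝ) / m) • w ∈ strictRegion b (pairSource p) := by
  obtain ⟨n, hn, h⟩ := (mem_strictRegion_iff hb).1 hv
  obtain ⟨n', hn', h'⟩ := (mem_strictRegion_iff hb).1 hw
  obtain ⟨l, rfl⟩ := Nat.exists_eq_add_of_le hk
  refine (mem_strictRegion_iff hb).2 ⟨(k + l) * (n * n'), by positivity, ?_⟩
  -- With `m = k + l`, the code for `v` runs `k * n'` times and the code for `w` runs `l * n` times,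
  -- so they occupy `k * n * n'` and `l * n * n'` symbols: the proportions `k / m` and `l / m`.
  convert (h.nsmul (k * n')).add (h'.nsmul (l * n)) using 1
  · ring
  · have : ((k : ℝ) + l) ≠ 0 := by exact_mod_cast hm.ne'
    simp only [smul_add, smul_smul]
    push_cast
    congr 2 <;> field_simp
    ring

theorem convex_region {b : ℝ} (hb : 1 < b) (p : PMF (Y₁ × Y₂)) :
    Convex ℝ (region b (pairSource p)) := by
  have key : ∀ v ∈ strictRegion b (pairSource p), ∀ w ∈ strictRegion b (pairSource p),
      ∀ t : ℝ, 0 ≤ t → t ≤ 1 → t • v + (1 - t) • w ∈ region b (pairSource p) := by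
    intro v hv w hw t h0 h1
    -- A real weight `t` is the limit of the rational weights `⌊t * m⌋₊ / m`.
    have hlim : Filter.Tendsto (fun m : ℕ => ((⌊t * m⌋₊ : ℝ) / m)) Filter.atTop (nhds t) :=
      (tendsto_nat_floor_mul_div_atTop h0).comp tendsto_natCast_atTop_atTop
    refine mem_closure_of_tendsto ((hlim.smul_const v).add
      ((tendsto_const_nhds.sub hlim).smul_const w)) ?_
    filter_upwards [Filter.eventually_gt_atTop 0] with m hm
    refine strictRegion_rat_convex hb hv hw hm ?_
    refine Nat.floor_le_of_le ?_
    exact mul_le_of_le_one_left (Nat.cast_nonneg m) h1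
  intro v hv w hw s t hs ht hst
  have hcont : Continuous fun x : (ℝ × ℝ × ℝ) × (ℝ × ℝ × ℝ) => s • x.1 + t • x.2 := by fun_prop
  have h := map_mem_closure₂ (u := region b (pairSource p))
    (f := fun x y : ℝ × ℝ × ℝ => s • x + t • y) hcont hv hw ?_
  · rwa [region, closure_closure] at h
  · intro x hx y hy
    have := key x hx y hy s hs (by linarith)
    rwa [show 1 - s = t by linarith] at this

/-- Translation by `w - v ≥ 0` maps the strict region into itself, hence also its closure. -/
theorem region_upward {b : ℝ} {p : PMF (Y₁ × Y₂)} {v w : ℝ × ℝ × ℝ}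
    (hv : v ∈ region b (pairSource p)) (h : v ≤ w) : w ∈ region b (pairSource p) := by
  have h2 := map_mem_closure (f := fun x : ℝ × ℝ × ℝ => x + (w - v))
    (t := strictRegion b (pairSource p)) (by fun_prop) hv ?_
  · simpa [region] using h2
  · rintro x ⟨n, M₁, M₂, hn, c, h1, h2, h3⟩
    refine ⟨n, M₁, M₂, hn, c, ?_, ?_, ?_⟩
    · exact h1.trans (le_add_of_nonneg_right (sub_nonneg.2 h.1))
    · exact h2.trans (le_add_of_nonneg_right (sub_nonneg.2 h.2.1))
    · exact h3.trans (EReal.coe_le_coe_iff.2 (le_add_of_nonneg_right (sub_nonneg.2 h.2.2)))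

/-- A closed, convex, upward closed set that contains the five extreme points contains the
polyhedron. -/
theorem mem_of_extreme_points {S : Set (ℝ × ℝ × ℝ)} (hconv : Convex ℝ S) (hcl : IsClosed S)
    (hup : ∀ v ∈ S, ∀ w, v ≤ w → w ∈ S) {h₁ h₂ h : ℝ}
    (p0 : (0, 0, h) ∈ S) (p1 : (0, h - h₁, h₁) ∈ S) (p2 : (h - h₂, 0, h₂) ∈ S)
    (p3 : (h₁, h - h₁, 0) ∈ S) (p4 : (h - h₂, h₂, 0) ∈ S)
    {x y z : ℝ} (hx : 0 ≤ x) (hy : 0 ≤ y) (hz : 0 ≤ z) (c1 : h₁ - z ≤ x) (c2 : h₂ - z ≤ y)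
    (c3 : h - z ≤ x + y) : (x, y, z) ∈ S := by
  by_contra hnot
  -- A separating functional has nonnegative coefficients because `S` is upward closed; it then
  -- remains to see that its value at `(x, y, z)` is at least its value at one of the five points.
  obtain ⟨f, u, hf, hu⟩ := geometric_hahn_banach_point_closed hconv hcl hnot
  set α := f (1, 0, 0) with hα
  set β := f (0, 1, 0) with hβ
  set γ := f (0, 0, 1) with hγ
  have hlin : ∀ x y z : ℝ, f (x, y, z) = x * α + y * β + z * γ := by
    intro x y z
    have : (x, y, z) = x • ((1, 0, 0) : ℝ × ℝ × ℝ) + y • ((0, 1, 0) : ℝ × ℝ × ℝ)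
        + z • ((0, 0, 1) : ℝ × ℝ × ℝ) := by simp
    rw [this, map_add, map_add, map_smul, map_smul, map_smul]
    rfl
  have pos : ∀ a : ℝ, (∀ t : ℝ, 0 ≤ t → u < h * γ + t * a) → 0 ≤ a := by
    intro a ha
    by_contra hneg
    push Not at hneg
    have h0 := ha 0 le_rfl
    have := ha ((u - h * γ) / a) (div_nonneg_of_nonpos (by linarith) hneg.le)
    rw [div_mul_cancel₀ _ hneg.ne] at this
    linarith
  have hα0 : 0 ≤ α := pos α fun t ht => by
    have := hu _ (hup _ p0 (t, 0, h) ⟨ht, le_rfl, le_rfl⟩)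
    rw [hlin] at this
    linarith
  have hβ0 : 0 ≤ β := pos β fun t ht => by
    have := hu _ (hup _ p0 (0, t, h) ⟨le_rfl, ht, le_rfl⟩)
    rw [hlin] at this
    linarith
  have hγ0 : 0 ≤ γ := pos γ fun t ht => by
    have := hu _ (hup _ p0 (0, 0, h + t) ⟨le_rfl, le_rfl, le_add_of_nonneg_right ht⟩)
    rw [hlin] at this
    linarith
  rw [hlin] at hf
  have q0 := hu _ p0
  have q1 := hu _ p1
  have q2 := hu _ p2
  have q3 := hu _ p3
  have q4 := hu _ p4
  rw [hlin] at q0 q1 q2 q3 q4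
  -- The order of the coefficients selects the point, by Abel summation. For `α ≤ β ≤ γ`, the value
  -- is `α * (x + y + z) + (β - α) * (y + z) + (γ - β) * z ≥ α * h + (β - α) * h₂`, the value at
  -- `p4`. Likewise `α ≤ γ ≤ β` uses `p2`, `β ≤ α ≤ γ` uses `p3`, `β ≤ γ ≤ α` uses `p1`, and a
  -- smallest `γ` uses `p0`. The two cyclic cases force all coefficients to be equal.
  rcases le_total α β with hab | hab <;> rcases le_total β γ with hbc | hbc <;>
    rcases le_total α γ with hac | hac
  · nlinarith [mul_nonneg hα0 (sub_nonneg.2 c3), mul_nonneg (sub_nonneg.2 hab) (sub_nonneg.2 c2),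
      mul_nonneg (sub_nonneg.2 hbc) hz]
  · have e : γ = α := by linarith
    nlinarith [mul_nonneg hα0 (sub_nonneg.2 c3), mul_nonneg (sub_nonneg.2 hab) (sub_nonneg.2 c2),
      mul_nonneg (sub_nonneg.2 hab) hy]
  · nlinarith [mul_nonneg hα0 (sub_nonneg.2 c3), mul_nonneg (sub_nonneg.2 hac) (sub_nonneg.2 c2),
      mul_nonneg (sub_nonneg.2 hbc) hy]
  · nlinarith [mul_nonneg hγ0 (sub_nonneg.2 c3), mul_nonneg (sub_nonneg.2 hac) hx,
      mul_nonneg (sub_nonneg.2 hbc) hy]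
  · nlinarith [mul_nonneg hβ0 (sub_nonneg.2 c3), mul_nonneg (sub_nonneg.2 hab) (sub_nonneg.2 c1),
      mul_nonneg (sub_nonneg.2 hac) hz]
  · nlinarith [mul_nonneg hβ0 (sub_nonneg.2 c3), mul_nonneg (sub_nonneg.2 hbc) (sub_nonneg.2 c1),
      mul_nonneg (sub_nonneg.2 hac) hx]
  · have e : γ = β := by linarith
    nlinarith [mul_nonneg hβ0 (sub_nonneg.2 c3), mul_nonneg (sub_nonneg.2 hab) hx]
  · nlinarith [mul_nonneg hγ0 (sub_nonneg.2 c3), mul_nonneg (sub_nonneg.2 hac) hx,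
      mul_nonneg (sub_nonneg.2 hbc) hy]

end

/-! ### Random binning and source coding with side information -/

section

/-- Two distinct points collide under at most a fraction `1 / M` of all maps to `Fin M`. -/
theorem card_collision_mul_le {A : Type*} [Fintype A] [DecidableEq A] (M : ℕ) {a a' : A}
    (h : a' ≠ a) :
    (Finset.univ.filter fun f : A → Fin M => f a' = f a).card * M ≤
      Fintype.card (A → Fin M) := by
  -- Overwriting `f a` loses nothing, since the old value equals `f a'`, which is still readable;
  -- the new value records `m`.
  have := Fintype.card_le_of_injective
    (fun x : {f : A → Fin M // f a' = f a} × Fin M => Function.update x.1.1 a x.2) ?_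
  · rwa [Fintype.card_prod, Fintype.card_fin, Fintype.card_subtype] at this
  · rintro ⟨⟨f, hf⟩, m⟩ ⟨⟨g, hg⟩, m'⟩ hfg
    have hval : ∀ x, Function.update f a m x = Function.update g a m' x := congrFun hfg
    have hm : m = m' := by simpa using hval a
    have hne : ∀ x, x ≠ a → f x = g x := fun x hx => by
      simpa [Function.update_of_ne hx] using hval x
    have hfg' : f = g := by
      funext x
      by_cases hx : x = a
      · rw [hx, ← hf, ← hg, hne a' h]
      · exact hne x hx
    subst hm hfg'
    rfl

/-- Random binning: some binning `f` with `M` bins can be decoded by looking in the bin for an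
element of the list `T c` determined by the side information `c`. -/
theorem exists_binning {S A C : Type*} [Fintype S] [Fintype A] [DecidableEq A] [Nonempty A]
    (w : S → ℝ) (hw : ∀ s, 0 ≤ w s) (α : S → A) (β : S → C) (T : C → Finset A) {N : ℝ}
    (hT : ∀ c, ((T c).card : ℝ) ≤ N) {M : ℕ} (hM : 0 < M) :
    ∃ (f : A → Fin M) (g : Fin M → C → A),
      ∑ s with g (f (α s)) (β s) ≠ α s, w s ≤
        ∑ s with α s ∉ T (β s), w s + N / M * ∑ s, w s := by
  classical
  have hM' : (0 : ℝ) < M := by exact_mod_cast hM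
  have : Nonempty (Fin M) := ⟨⟨0, hM⟩⟩
  let coll : (A → Fin M) → ℝ := fun f =>
    ∑ s, w s * ∑ a' ∈ (T (β s)).erase (α s), if f a' = f (α s) then 1 else 0
  -- Averaged over all binnings, each of the at most `N` competitors shares the bin of `α s` with
  -- probability at most `1 / M`. Some `f` does no worse than this average.
  have havg : ∑ f, coll f ≤ ∑ _f : A → Fin M, N / M * ∑ s, w s := by
    rw [Finset.sum_comm, Finset.sum_const, Finset.card_univ, nsmul_eq_mul, Finset.mul_sum,
      Finset.mul_sum]
    refine Finset.sum_le_sum fun s _ => ?_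
    rw [← Finset.mul_sum, Finset.sum_comm]
    have h1 : ∑ a' ∈ (T (β s)).erase (α s), ∑ f : A → Fin M,
        (if f a' = f (α s) then (1 : ℝ) else 0) ≤
        ∑ _a' ∈ (T (β s)).erase (α s), (Fintype.card (A → Fin M) : ℝ) / M := by
      refine Finset.sum_le_sum fun a' ha' => ?_
      rw [Finset.sum_boole, le_div_iff₀ hM']
      exact_mod_cast card_collision_mul_le M (Finset.ne_of_mem_erase ha')
    have h2 : (((T (β s)).erase (α s)).card : ℝ) ≤ N :=
      (Nat.cast_le.2 (Finset.card_le_card (Finset.erase_subset _ _))).trans (hT _)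
    rw [Finset.sum_const, nsmul_eq_mul] at h1
    have h3 := mul_le_mul_of_nonneg_right h2
      (show 0 ≤ (Fintype.card (A → Fin M) : ℝ) / M by positivity)
    calc _ ≤ w s * (N * ((Fintype.card (A → Fin M) : ℝ) / M)) :=
          mul_le_mul_of_nonneg_left (h1.trans h3) (hw s)
      _ = _ := by ring
  obtain ⟨f, -, hf⟩ := Finset.exists_le_of_sum_le Finset.univ_nonempty havg
  let g : Fin M → C → A := fun m c =>
    if h : ∃ a ∈ T c, f a = m then h.choose else Classical.arbitrary A
  refine ⟨f, g, ?_⟩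
  refine le_trans ?_ (add_le_add_right hf _)
  rw [Finset.sum_filter, Finset.sum_filter, ← Finset.sum_add_distrib]
  refine Finset.sum_le_sum fun s _ => ?_
  have hcoll : 0 ≤ w s * ∑ a' ∈ (T (β s)).erase (α s), if f a' = f (α s) then (1 : ℝ) else 0 :=
    mul_nonneg (hw s) (Finset.sum_nonneg fun _ _ => by positivity)
  by_cases hmem : α s ∈ T (β s)
  · rw [if_neg (not_not.2 hmem), zero_add]
    split_ifs with herr
    · have hex : ∃ a ∈ T (β s), f a = f (α s) := ⟨α s, hmem, rfl⟩
      have hg : g (f (α s)) (β s) = hex.choose := dif_pos hex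
      rw [hg] at herr
      refine le_mul_of_one_le_right (hw s) ?_
      refine le_trans ?_ (Finset.single_le_sum (fun _ _ => by positivity)
        (Finset.mem_erase.2 ⟨herr, hex.choose_spec.1⟩))
      rw [if_pos hex.choose_spec.2]
    · exact hcoll
  · rw [if_pos hmem]
    split_ifs
    · linarith
    · linarith [hw s]

/-- Exponential decay of the upper tail of a sum of independent copies of `L`. -/
theorem exists_chernoff {Z : Type*} [Fintype Z] {P : Z → ℝ} (h0 : ∀ z, 0 ≤ P z)
    (h1 : ∑ z, P z = 1) (L : Z → ℝ) {ε : ℝ} (hε : 0 < ε) :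
    ∃ ρ : ℝ, 0 ≤ ρ ∧ ρ < 1 ∧ ∀ (n : ℕ) (bad : Finset (Fin n → Z)),
      (∀ s ∈ bad, n * ((∑ z, P z * L z) + ε) ≤ ∑ j, L (s j)) →
        ∑ s ∈ bad, ∏ j, P (s j) ≤ ρ ^ n := by
  set h := ∑ z, P z * L z with hh
  let φ : ℝ → ℝ := fun t => ∑ z, P z * Real.exp (t * (L z - h - ε))
  have hφ0 : φ 0 = 1 := by simp [φ, h1]
  have hder : HasDerivAt φ (-ε) 0 := by
    have : HasDerivAt φ (∑ z, P z * (Real.exp (0 * (L z - h - ε)) * (1 * (L z - h - ε)))) 0 :=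
      HasDerivAt.fun_sum fun z _ =>
        (((hasDerivAt_id (0 : ℝ)).mul_const (L z - h - ε)).exp).const_mul (P z)
    convert this using 1
    simp only [zero_mul, Real.exp_zero, one_mul]
    simp only [mul_sub, Finset.sum_sub_distrib, ← Finset.sum_mul, h1, ← hh]
    ring
  -- Since `φ 0 = 1` and `φ' 0 = -ε < 0`, the function drops below one just to the right of `0`; `ρ`
  -- is such a value `φ t`.
  obtain ⟨t, ht0, ht⟩ : ∃ t : ℝ, 0 < t ∧ φ t < 1 := by
    have hs := (hasDerivAt_iff_tendsto_slope.1 hder).mono_left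
      (nhdsWithin_mono 0 (s := Set.Ioi 0) fun x hx => ne_of_gt hx)
    have hev := hs.eventually (gt_mem_nhds (neg_lt_zero.2 hε))
    obtain ⟨t, htlt, ht0⟩ := (hev.and self_mem_nhdsWithin).exists
    refine ⟨t, ht0, ?_⟩
    rw [slope_def_field, sub_zero, hφ0] at htlt
    have := (div_neg_iff.1 htlt).resolve_left fun h => absurd ht0 (not_lt.2 h.2.le)
    linarith [this.1]
  refine ⟨φ t, Finset.sum_nonneg fun z _ => mul_nonneg (h0 z) (Real.exp_pos _).le, ht, ?_⟩
  intro n bad hbad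
  calc ∑ s ∈ bad, ∏ j, P (s j)
      -- On `bad` the total exponent is nonnegative, so the exponential factors only increase the
      -- sum.
      ≤ ∑ s ∈ bad, ∏ j, P (s j) * Real.exp (t * (L (s j) - h - ε)) := by
        refine Finset.sum_le_sum fun s hs => ?_
        rw [Finset.prod_mul_distrib, ← Real.exp_sum]
        refine le_mul_of_one_le_right (Finset.prod_nonneg fun _ _ => h0 _) ?_
        rw [← Finset.mul_sum, Real.one_le_exp_iff]
        refine mul_nonneg ht0.le ?_
        have := hbad s hs
        simp only [Finset.sum_sub_distrib, Finset.sum_const, Finset.card_univ, Fintype.card_fin,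
          nsmul_eq_mul]
        linarith
    _ ≤ ∑ s : Fin n → Z, ∏ j, P (s j) * Real.exp (t * (L (s j) - h - ε)) :=
        Finset.sum_le_univ_sum_of_nonneg fun s =>
          Finset.prod_nonneg fun _ _ => mul_nonneg (h0 _) (Real.exp_pos _).le
    _ = φ t ^ n := by
        rw [← prod_sum_eq_sum_prod (fun _ z => P z * Real.exp (t * (L z - h - ε)))]
        simp [φ]

/-- There are at most `1 / τ` sequences of mass at least `τ` under a product kernel `∏ κ`. -/
theorem card_mul_le_one {A C : Type*} [Fintype A] {κ : A → C → ℝ} (hκ0 : ∀ a c, 0 ≤ κ a c)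
    (hκ1 : ∀ c, ∑ a, κ a c ≤ 1) {n : ℕ} (c : Fin n → C) (τ : ℝ) (T : Finset (Fin n → A))
    (hT : ∀ a ∈ T, τ ≤ ∏ j, κ (a j) (c j)) : T.card * τ ≤ 1 := by
  calc T.card * τ = ∑ _a ∈ T, τ := by simp
    _ ≤ ∑ a ∈ T, ∏ j, κ (a j) (c j) := Finset.sum_le_sum hT
    _ ≤ ∑ a : Fin n → A, ∏ j, κ (a j) (c j) :=
        Finset.sum_le_univ_sum_of_nonneg fun a => Finset.prod_nonneg fun _ _ => hκ0 _ _
    _ = ∏ j, ∑ a, κ a (c j) := (prod_sum_eq_sum_prod fun j a => κ a (c j)).symm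
    _ ≤ 1 := Finset.prod_le_one (fun j _ => Finset.sum_nonneg fun a _ => hκ0 _ _) fun j _ => hκ1 _

/-- Source coding with side information at the decoder. The rate is the expected ideal code length
of `α z` given `β z` for a kernel `κ`. -/
theorem exists_sideInfo_code {Z A C : Type*} [Fintype Z] [Fintype A] {b : ℝ}
    (hb : 1 < b) {P : Z → ℝ} (h0 : ∀ z, 0 ≤ P z) (h1 : ∑ z, P z = 1) (α : Z → A) (β : Z → C)
    {κ : A → C → ℝ} (hκ0 : ∀ a c, 0 ≤ κ a c) (hκ1 : ∀ c, ∑ a, κ a c ≤ 1)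
    (hpos : ∀ z, P z ≠ 0 → 0 < κ (α z) (β z)) {ε η : ℝ} (hε : 0 < ε) (hη : 0 < η) :
    ∀ᶠ n : ℕ in Filter.atTop, ∃ (M : ℕ) (f : (Fin n → A) → Fin M)
      (g : Fin M → (Fin n → C) → (Fin n → A)) (bad : Finset (Fin n → Z)),
      Real.logb b M ≤ n * ((∑ z, P z * -Real.logb b (κ (α z) (β z))) + ε) ∧
      (∀ s ∉ bad, g (f fun j => α (s j)) (fun j => β (s j)) = fun j => α (s j)) ∧
      ∑ s ∈ bad, ∏ j, P (s j) ≤ η := by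
  classical
  have hb0 : 0 < b := by linarith
  obtain ⟨z₀⟩ : Nonempty Z := by
    by_contra hne
    rw [not_nonempty_iff] at hne
    simp at h1
  have : Nonempty A := ⟨α z₀⟩
  set L : Z → ℝ := fun z => -Real.logb b (κ (α z) (β z)) with hL
  set h := ∑ z, P z * L z with hh
  have hhn : 0 ≤ h := Finset.sum_nonneg fun z _ => mul_nonneg (h0 z) (neg_logb_nonneg hb (hκ0 _ _)
    ((Finset.single_le_sum (f := fun a => κ a (β z)) (fun a _ => hκ0 a _)
      (Finset.mem_univ (α z))).trans (hκ1 _)))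
  -- One `δ` is the slack in the typicality threshold `τ`, one makes the number of bins exceed the
  -- list size by the factor `b ^ (n * δ)`, and one absorbs the factor `2` from rounding `M` up.
  set δ := ε / 3 with hδ
  have hδ0 : 0 < δ := by positivity
  obtain ⟨ρ, hρ0, hρ1, hρ⟩ := exists_chernoff h0 h1 L hδ0
  have hlim : Filter.Tendsto (fun n : ℕ => ρ ^ n + (b ^ (-δ)) ^ n) Filter.atTop (nhds 0) := by
    rw [← add_zero (0 : ℝ)]
    exact (tendsto_pow_atTop_nhds_zero_of_lt_one hρ0 hρ1).add
      (tendsto_pow_atTop_nhds_zero_of_lt_one (Real.rpow_nonneg hb0.le _)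
        (Real.rpow_lt_one_of_one_lt_of_neg hb (neg_lt_zero.2 hδ0)))
  filter_upwards [hlim.eventually (gt_mem_nhds hη),
    tendsto_natCast_atTop_atTop.eventually (Filter.eventually_ge_atTop (Real.logb b 2 / δ))]
    with n hn1 hn2
  set M := ⌈b ^ (n * (h + 2 * δ))⌉₊ with hMdef
  have hbp : 0 < b ^ (n * (h + 2 * δ)) := Real.rpow_pos_of_pos hb0 _
  have hM : 0 < M := Nat.ceil_pos.2 hbp
  have hM' : (0 : ℝ) < M := by exact_mod_cast hM
  set τ := b ^ (-(n * (h + δ))) with hτ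
  have hτ0 : 0 < τ := Real.rpow_pos_of_pos hb0 _
  let T : (Fin n → C) → Finset (Fin n → A) := fun c =>
    Finset.univ.filter fun a => τ ≤ ∏ j, κ (a j) (c j)
  have hT : ∀ c, ((T c).card : ℝ) ≤ 1 / τ := fun c => by
    rw [le_div_iff₀ hτ0]
    exact card_mul_le_one hκ0 hκ1 c τ (T c) fun a ha => (Finset.mem_filter.1 ha).2
  obtain ⟨f, g, hfg⟩ := exists_binning (fun s : Fin n → Z => ∏ j, P (s j))
    (fun s => Finset.prod_nonneg fun _ _ => h0 _) (fun s j => α (s j)) (fun s j => β (s j)) T hT hM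
  refine ⟨M, f, g, _, ?_, ?_, hfg.trans (le_trans (add_le_add ?_ ?_) hn1.le)⟩
  · have hge : 1 ≤ b ^ (n * (h + 2 * δ)) := Real.one_le_rpow hb.le (by positivity)
    have hle : (M : ℝ) ≤ 2 * b ^ (n * (h + 2 * δ)) := by
      have := (Nat.ceil_lt_add_one hbp.le).le
      rw [← hMdef] at this
      linarith
    calc Real.logb b M ≤ Real.logb b (2 * b ^ (n * (h + 2 * δ))) :=
          Real.logb_le_logb_of_le hb hM' hle
      _ = Real.logb b 2 + n * (h + 2 * δ) := by
          rw [Real.logb_mul two_ne_zero hbp.ne', Real.logb_rpow hb0 hb.ne']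
      _ ≤ n * δ + n * (h + 2 * δ) := by
          have := (div_le_iff₀ hδ0).1 hn2
          linarith
      _ = n * (h + ε) := by rw [hδ]; ring
  · intro s hs
    simpa using hs
  -- Sequences of zero mass are dropped first: on the others every kernel value is positive and the
  -- logarithm of the product splits.
  · rw [← Finset.sum_filter_ne_zero]
    refine hρ n _ fun s hs => ?_
    simp only [Finset.mem_filter, Finset.mem_univ, true_and, T, not_le] at hs
    have hp : ∀ j, 0 < κ (α (s j)) (β (s j)) := fun j =>
      hpos _ fun hz => hs.2 (Finset.prod_eq_zero (Finset.mem_univ j) hz)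
    have hlog := Real.logb_lt_logb hb (Finset.prod_pos fun j _ => hp j) hs.1
    rw [hτ, Real.logb_rpow hb0 hb.ne', Real.logb_prod _ _ fun j _ => (hp j).ne'] at hlog
    simp only [hL, Finset.sum_neg_distrib]
    linarith
  · rw [sum_prod_eq_one h1, mul_one, div_le_iff₀ hM', one_div, hτ, ← Real.rpow_neg hb0.le,
      ← Real.rpow_natCast, ← Real.rpow_mul hb0.le]
    refine le_trans (le_of_eq ?_) (mul_le_mul_of_nonneg_left (Nat.le_ceil _)
      (Real.rpow_nonneg hb0.le _))
    rw [← Real.rpow_add hb0]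
    congr 1
    ring

end

/-! ### Achievability of the five extreme points -/

section

/-- A pmf that dominates both a scaled sub-probability vector and a multiple of the uniform
distribution. -/
theorem exists_pmf_ge {Z : Type*} [Fintype Z] [Nonempty Z] {k : Z → ℝ} (h0 : ∀ z, 0 ≤ k z)
    (h1 : ∑ z, k z ≤ 1) {δ : ℝ} (hδ0 : 0 ≤ δ) (hδ1 : δ ≤ 1) :
    ∃ q : PMF Z, ∀ z, (1 - δ) * k z ≤ (q z).toReal ∧ δ / Fintype.card Z ≤ (q z).toReal := by
  have hcard : (0 : ℝ) < Fintype.card Z := by exact_mod_cast Fintype.card_pos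
  -- The mass missing from `(1 - δ) * k`, at least `δ` in total, is spread uniformly.
  set u := (1 - (1 - δ) * ∑ z, k z) / Fintype.card Z with hu
  have hδu : δ / Fintype.card Z ≤ u := by
    rw [hu]
    gcongr
    nlinarith
  have hu0 : 0 ≤ u := (div_nonneg hδ0 hcard.le).trans hδu
  have hk : ∀ z, 0 ≤ (1 - δ) * k z := fun z => mul_nonneg (by linarith) (h0 z)
  refine ⟨PMF.ofFintype (fun z => ENNReal.ofReal ((1 - δ) * k z + u)) ?_, fun z => ?_⟩
  · rw [← ENNReal.ofReal_sum_of_nonneg fun z _ => add_nonneg (hk z) hu0, Finset.sum_add_distrib,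
      ← Finset.mul_sum, Finset.sum_const, Finset.card_univ, nsmul_eq_mul, hu,
      mul_div_cancel₀ _ hcard.ne']
    simp
  · rw [PMF.ofFintype_apply, ENNReal.toReal_ofReal (add_nonneg (hk z) hu0)]
    exact ⟨by linarith, by linarith [hk z]⟩

variable {Y₁ Y₂ : Type*} [Fintype Y₁] [Fintype Y₂]

/-- If the decoder can recover the symbols `w z` with small error probability at rates `r₁`, `r₂`,
then the loss of guessing `z` from `w z` by a kernel `κ` is achievable at these rates. -/
theorem mem_region_of_decodable {b : ℝ} (hb : 1 < b) {p : PMF (Y₁ × Y₂)} {W : Type*}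
    (w : Y₁ × Y₂ → W) {κ : W → Y₁ × Y₂ → ℝ} (hκ0 : ∀ v z, 0 ≤ κ v z) (hκ1 : ∀ v, ∑ z, κ v z ≤ 1)
    (hκpos : ∀ z, p z ≠ 0 → 0 < κ (w z) z) {r₁ r₂ d : ℝ}
    (hd : ∑ z, (p z).toReal * -Real.logb b (κ (w z) z) = d)
    (hdec : ∀ ε > 0, ∀ η > 0, ∃ n : ℕ, 0 < n ∧ ∃ (M₁ M₂ : ℕ) (f₁ : (Fin n → Y₁) → Fin M₁)
      (f₂ : (Fin n → Y₂) → Fin M₂) (g : Fin M₁ → Fin M₂ → Fin n → W)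
      (bad : Finset (Fin n → Y₁ × Y₂)),
      Real.logb b M₁ ≤ n * (r₁ + ε) ∧ Real.logb b M₂ ≤ n * (r₂ + ε) ∧
      (∀ s ∉ bad, g (f₁ fun j => (s j).1) (f₂ fun j => (s j).2) = fun j => w (s j)) ∧
      ∑ s ∈ bad, ∏ j, (p (s j)).toReal ≤ η) :
    (r₁, r₂, d) ∈ region b (pairSource p) := by
  classical
  have hb0 : 0 < b := by linarith
  have : Nonempty (Y₁ × Y₂) := ⟨p.support_nonempty.choose⟩
  have hcard : (1 : ℝ) ≤ Fintype.card (Y₁ × Y₂) := by exact_mod_cast Fintype.card_pos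
  have key : ∀ ε > 0, (r₁ + ε, r₂ + ε, d + ε) ∈ strictRegion b (pairSource p) := by
    intro ε hε
    have hβ0 : 0 < b ^ (-(ε / 2)) := Real.rpow_pos_of_pos hb0 _
    have hβ1 : b ^ (-(ε / 2)) < 1 := Real.rpow_lt_one_of_one_lt_of_neg hb (by linarith)
    -- Chosen so that `-logb b (1 - δ) = ε / 2`: on correct decoding the mixing costs at most `ε /
    -- 2` per symbol.
    set δ := 1 - b ^ (-(ε / 2)) with hδ
    have hδ0 : 0 < δ := by linarith
    have hδ1 : δ < 1 := by linarith
    have hδc : 0 < δ / Fintype.card (Y₁ × Y₂) := by positivity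
    set K := -Real.logb b (δ / Fintype.card (Y₁ × Y₂)) with hK
    have hK0 : 0 ≤ K := neg_logb_nonneg hb hδc.le ((div_le_self hδ0.le hcard).trans hδ1.le)
    choose Q hQ using fun v => exists_pmf_ge (hκ0 v) (hκ1 v) hδ0.le hδ1.le
    obtain ⟨n, hn, M₁, M₂, f₁, f₂, g, bad, h1, h2, hgood, hbad⟩ :=
      -- The worst loss per symbol `K` does not depend on `n`, so the error probability can be
      -- chosen after it. Failures then add at most `ε / 2` per symbol; `K + 1` avoids dividing by
      -- zero.
      hdec ε hε (ε / 2 / (K + 1)) (by positivity)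
    have hQpos : ∀ v z, 0 < (Q v z).toReal := fun v z => hδc.trans_le (hQ v z).2
    have hL : ∀ z, 0 ≤ -Real.logb b (κ (w z) z) := fun z => neg_logb_nonneg hb (hκ0 _ _)
      ((Finset.single_le_sum (f := κ (w z)) (fun a _ => hκ0 _ a) (Finset.mem_univ z)).trans
        (hκ1 _))
    have hQK : ∀ v z, -Real.logb b (Q v z).toReal ≤ K := fun v z =>
      neg_le_neg (Real.logb_le_logb_of_le hb hδc (hQ v z).2)
    have hQL : ∀ z, p z ≠ 0 →
        -Real.logb b (Q (w z) z).toReal ≤ ε / 2 + -Real.logb b (κ (w z) z) := fun z hz => by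
      have hk := hκpos z hz
      have := Real.logb_le_logb_of_le hb (mul_pos (by linarith) hk) (hQ (w z) z).1
      rw [Real.logb_mul (by linarith) hk.ne', hδ, sub_sub_cancel,
        Real.logb_rpow hb0 hb.ne'] at this
      linarith
    refine (mem_strictRegion_iff hb).2 ⟨n, hn, M₁, M₂, ⟨f₁, f₂, fun m₁ m₂ j => Q (g m₁ m₂ j)⟩,
      h1, h2, ?_, ?_⟩
    · intro z _ j h
      exact (hQpos _ (z j)).ne' ((ENNReal.toReal_eq_zero_iff _).2 (Or.inl h))
    · have hterm : ∀ s : Fin n → Y₁ × Y₂, (∏ j, (p (s j)).toReal) *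
          ∑ j, -Real.logb b
            (Q (g (f₁ fun j => (s j).1) (f₂ fun j => (s j).2) j) (s j)).toReal ≤
          (∏ j, (p (s j)).toReal) * ∑ j, (ε / 2 + -Real.logb b (κ (w (s j)) (s j))) +
            if s ∈ bad then (∏ j, (p (s j)).toReal) * (n * K) else 0 := by
        intro s
        have hP : 0 ≤ ∏ j, (p (s j)).toReal := Finset.prod_nonneg fun _ _ => ENNReal.toReal_nonneg
        have hnn : 0 ≤ ∑ j, (ε / 2 + -Real.logb b (κ (w (s j)) (s j))) :=
          Finset.sum_nonneg fun j _ => add_nonneg (by positivity) (hL _)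
        split_ifs with hs
        · refine le_add_of_nonneg_of_le (mul_nonneg hP hnn) (mul_le_mul_of_nonneg_left ?_ hP)
          refine (Finset.sum_le_sum fun j _ => hQK _ _).trans (le_of_eq ?_)
          simp
        · rw [add_zero, hgood s hs]
          by_cases hz : ∀ j, p (s j) ≠ 0
          · exact mul_le_mul_of_nonneg_left (Finset.sum_le_sum fun j _ => hQL _ (hz j)) hP
          · push Not at hz
            obtain ⟨j, hj⟩ := hz
            rw [Finset.prod_eq_zero (Finset.mem_univ j)
              (show (p (s j)).toReal = 0 by rw [hj]; rfl)]
            simp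
      refine (Finset.sum_le_sum fun s _ => hterm s).trans ?_
      rw [Finset.sum_add_distrib, sum_prod_mul_sum (sum_toReal p)
        (fun z => ε / 2 + -Real.logb b (κ (w z) z)), Finset.sum_ite_mem, Finset.univ_inter,
        ← Finset.sum_mul]
      have e1 : ∑ z, (p z).toReal * (ε / 2 + -Real.logb b (κ (w z) z)) = ε / 2 + d := by
        simp only [mul_add, Finset.sum_add_distrib]
        rw [← Finset.sum_mul, sum_toReal, one_mul, hd]
      have e2 : (∑ s ∈ bad, ∏ j, (p (s j)).toReal) * (n * K) ≤ n * (ε / 2) := by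
        refine (mul_le_mul_of_nonneg_right hbad (by positivity)).trans ?_
        rw [div_mul_eq_mul_div, div_le_iff₀ (by positivity)]
        nlinarith [show 0 ≤ (n : ℝ) * ε by positivity]
      rw [e1]
      change _ ≤ (n : ℝ) * (d + ε)
      linarith
  have hlim : Filter.Tendsto (fun ε : ℝ => (r₁ + ε, r₂ + ε, d + ε)) (nhdsWithin 0 (Set.Ioi 0))
      (nhds (r₁, r₂, d)) := by
    have : Continuous fun ε : ℝ => (r₁ + ε, r₂ + ε, d + ε) := by fun_prop
    simpa using (this.tendsto 0).mono_left nhdsWithin_le_nhds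
  exact mem_closure_of_tendsto hlim (by
    filter_upwards [self_mem_nhdsWithin] with ε hε using key ε hε)

/-- The chain rule: the left side is the entropy of the second source. -/
theorem sum_neg_logb_snd (b : ℝ) (p : PMF (Y₁ × Y₂)) :
    ∑ z, (p z).toReal * -Real.logb b (p.map Prod.snd z.2).toReal =
      entropy b p - condEntropy b p := by
  rw [entropy, condEntropy, neg_sub_neg, ← Finset.sum_sub_distrib]
  refine Finset.sum_congr rfl fun z _ => ?_
  by_cases hz : p z = 0
  · simp [hz]
  · rw [Real.logb_div (toReal_pos hz).ne' (toReal_pos (map_apply_ne_zero _ hz)).ne']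
    ring

theorem sum_neg_logb_fst (b : ℝ) (p : PMF (Y₁ × Y₂)) :
    ∑ z, (p z).toReal * -Real.logb b (p.map Prod.fst z.1).toReal =
      entropy b p - condEntropy b (p.map Prod.swap) := by
  rw [entropy, condEntropy_swap, neg_sub_neg, ← Finset.sum_sub_distrib]
  refine Finset.sum_congr rfl fun z _ => ?_
  by_cases hz : p z = 0
  · simp [hz]
  · rw [Real.logb_div (toReal_pos hz).ne' (toReal_pos (map_apply_ne_zero _ hz)).ne']
    ring

/-- Equality fails only where the marginal vanishes: there division by zero makes the kernel zero,
hence merely a sub-probability. -/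
theorem sum_fst_div_le_one (p : PMF (Y₁ × Y₂)) (y : Y₂) :
    ∑ a, (p (a, y)).toReal / (p.map Prod.snd y).toReal ≤ 1 := by
  rw [← Finset.sum_div, ← map_snd_apply_toReal]
  exact div_self_le_one _

theorem sum_snd_div_le_one (p : PMF (Y₁ × Y₂)) (y : Y₁) :
    ∑ a, (p (y, a)).toReal / (p.map Prod.fst y).toReal ≤ 1 := by
  rw [← Finset.sum_div, ← map_fst_apply_toReal]
  exact div_self_le_one _

theorem exists_code_snd {b : ℝ} (hb : 1 < b) (p : PMF (Y₁ × Y₂)) {ε η : ℝ} (hε : 0 < ε)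
    (hη : 0 < η) :
    ∀ᶠ n : ℕ in Filter.atTop, ∃ (M : ℕ) (f : (Fin n → Y₂) → Fin M)
      (g : Fin M → (Fin n → Y₂)) (bad : Finset (Fin n → Y₁ × Y₂)),
      Real.logb b M ≤ n * ((entropy b p - condEntropy b p) + ε) ∧
      (∀ s ∉ bad, g (f fun j => (s j).2) = fun j => (s j).2) ∧
      ∑ s ∈ bad, ∏ j, (p (s j)).toReal ≤ η := by
  have h := exists_sideInfo_code hb (P := fun z => (p z).toReal)
    (fun z => ENNReal.toReal_nonneg) (sum_toReal p) Prod.snd (fun _ => ())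
    (κ := fun a _ => (p.map Prod.snd a).toReal) (fun _ _ => ENNReal.toReal_nonneg)
    (fun _ => (sum_toReal _).le)
    (fun z hz => toReal_pos (map_apply_ne_zero _ fun h => hz (by rw [h]; rfl))) hε hη
  rw [sum_neg_logb_snd] at h
  filter_upwards [h] with n ⟨M, f, g, bad, h1, h2, h3⟩
  exact ⟨M, f, fun m => g m fun _ => (), bad, h1, h2, h3⟩

theorem exists_code_fst {b : ℝ} (hb : 1 < b) (p : PMF (Y₁ × Y₂)) {ε η : ℝ} (hε : 0 < ε)
    (hη : 0 < η) :
    ∀ᶠ n : ℕ in Filter.atTop, ∃ (M : ℕ) (f : (Fin n → Y₁) → Fin M)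
      (g : Fin M → (Fin n → Y₁)) (bad : Finset (Fin n → Y₁ × Y₂)),
      Real.logb b M ≤ n * ((entropy b p - condEntropy b (p.map Prod.swap)) + ε) ∧
      (∀ s ∉ bad, g (f fun j => (s j).1) = fun j => (s j).1) ∧
      ∑ s ∈ bad, ∏ j, (p (s j)).toReal ≤ η := by
  have h := exists_sideInfo_code hb (P := fun z => (p z).toReal)
    (fun z => ENNReal.toReal_nonneg) (sum_toReal p) Prod.fst (fun _ => ())
    (κ := fun a _ => (p.map Prod.fst a).toReal) (fun _ _ => ENNReal.toReal_nonneg)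
    (fun _ => (sum_toReal _).le)
    (fun z hz => toReal_pos (map_apply_ne_zero _ fun h => hz (by rw [h]; rfl))) hε hη
  rw [sum_neg_logb_fst] at h
  filter_upwards [h] with n ⟨M, f, g, bad, h1, h2, h3⟩
  exact ⟨M, f, fun m => g m fun _ => (), bad, h1, h2, h3⟩

theorem exists_code_fst_given_snd {b : ℝ} (hb : 1 < b) (p : PMF (Y₁ × Y₂)) {ε η : ℝ} (hε : 0 < ε)
    (hη : 0 < η) :
    ∀ᶠ n : ℕ in Filter.atTop, ∃ (M : ℕ) (f : (Fin n → Y₁) → Fin M)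
      (g : Fin M → (Fin n → Y₂) → (Fin n → Y₁)) (bad : Finset (Fin n → Y₁ × Y₂)),
      Real.logb b M ≤ n * (condEntropy b p + ε) ∧
      (∀ s ∉ bad, g (f fun j => (s j).1) (fun j => (s j).2) = fun j => (s j).1) ∧
      ∑ s ∈ bad, ∏ j, (p (s j)).toReal ≤ η := by
  have h := exists_sideInfo_code hb (P := fun z => (p z).toReal)
    (fun z => ENNReal.toReal_nonneg) (sum_toReal p) Prod.fst Prod.snd
    (κ := fun a c => (p (a, c)).toReal / (p.map Prod.snd c).toReal)
    (fun _ _ => div_nonneg ENNReal.toReal_nonneg ENNReal.toReal_nonneg)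
    (sum_fst_div_le_one p)
    (fun z hz => div_pos (ENNReal.toReal_nonneg.lt_of_ne' hz)
      (toReal_pos (map_apply_ne_zero _ fun h => hz (by rw [h]; rfl)))) hε hη
  simp only [mul_neg, Finset.sum_neg_distrib] at h
  exact h

theorem exists_code_snd_given_fst {b : ℝ} (hb : 1 < b) (p : PMF (Y₁ × Y₂)) {ε η : ℝ} (hε : 0 < ε)
    (hη : 0 < η) :
    ∀ᶠ n : ℕ in Filter.atTop, ∃ (M : ℕ) (f : (Fin n → Y₂) → Fin M)
      (g : Fin M → (Fin n → Y₁) → (Fin n → Y₂)) (bad : Finset (Fin n → Y₁ × Y₂)),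
      Real.logb b M ≤ n * (condEntropy b (p.map Prod.swap) + ε) ∧
      (∀ s ∉ bad, g (f fun j => (s j).2) (fun j => (s j).1) = fun j => (s j).2) ∧
      ∑ s ∈ bad, ∏ j, (p (s j)).toReal ≤ η := by
  have h := exists_sideInfo_code hb (P := fun z => (p z).toReal)
    (fun z => ENNReal.toReal_nonneg) (sum_toReal p) Prod.snd Prod.fst
    (κ := fun a c => (p (c, a)).toReal / (p.map Prod.fst c).toReal)
    (fun _ _ => div_nonneg ENNReal.toReal_nonneg ENNReal.toReal_nonneg)
    (sum_snd_div_le_one p)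
    (fun z hz => div_pos (ENNReal.toReal_nonneg.lt_of_ne' hz)
      (toReal_pos (map_apply_ne_zero _ fun h => hz (by rw [h]; rfl)))) hε hη
  simp only [mul_neg, Finset.sum_neg_distrib] at h
  rw [condEntropy_swap]
  exact h

theorem no_rate_mem_region {b : ℝ} (hb : 1 < b) (p : PMF (Y₁ × Y₂)) :
    (0, 0, entropy b p) ∈ region b (pairSource p) := by
  refine mem_region_of_decodable hb (fun _ => ()) (κ := fun _ z => (p z).toReal)
    (fun _ _ => ENNReal.toReal_nonneg) (fun _ => (sum_toReal p).le) (fun z hz => toReal_pos hz)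
    (by simp [entropy]) ?_
  intro ε hε η hη
  refine ⟨1, one_pos, 1, 1, fun _ => 0, fun _ => 0, fun _ _ _ => (), ∅, ?_, ?_, ?_, ?_⟩
  · simpa using hε.le
  · simpa using hε.le
  · exact fun _ _ => rfl
  · simpa using hη.le

/-- The second source is described losslessly; the first encoder is silent, and the decoder outputs
the conditional law given the recovered symbol. -/
theorem only_snd_mem_region {b : ℝ} (hb : 1 < b) (p : PMF (Y₁ × Y₂)) :
    (0, entropy b p - condEntropy b p, condEntropy b p) ∈ region b (pairSource p) := by
  classical
  refine mem_region_of_decodable hb Prod.snd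
    (κ := fun y z => if z.2 = y then (p z).toReal / (p.map Prod.snd y).toReal else 0)
    (fun _ _ => ?_) (fun y => ?_) (fun z hz => ?_) ?_ ?_
  · split_ifs
    exacts [div_nonneg ENNReal.toReal_nonneg ENNReal.toReal_nonneg, le_rfl]
  · simpa [Fintype.sum_prod_type] using sum_fst_div_le_one p y
  · rw [if_pos rfl]
    exact div_pos (toReal_pos hz) (toReal_pos (map_apply_ne_zero _ hz))
  · simp [condEntropy]
  · intro ε hε η hη
    obtain ⟨n, ⟨M, f, g, bad, h1, h2, h3⟩, hn⟩ :=
      ((exists_code_snd hb p hε hη).and (Filter.eventually_gt_atTop 0)).exists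
    refine ⟨n, hn, 1, M, fun _ => 0, f, fun _ => g, bad, ?_, h1, h2, h3⟩
    simp only [Nat.cast_one, Real.logb_one, zero_add]
    positivity

theorem only_fst_mem_region {b : ℝ} (hb : 1 < b) (p : PMF (Y₁ × Y₂)) :
    (entropy b p - condEntropy b (p.map Prod.swap), 0, condEntropy b (p.map Prod.swap)) ∈
      region b (pairSource p) := by
  classical
  refine mem_region_of_decodable hb Prod.fst
    (κ := fun y z => if z.1 = y then (p z).toReal / (p.map Prod.fst y).toReal else 0)
    (fun _ _ => ?_) (fun y => ?_) (fun z hz => ?_) ?_ ?_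
  · split_ifs
    exacts [div_nonneg ENNReal.toReal_nonneg ENNReal.toReal_nonneg, le_rfl]
  · simpa [Fintype.sum_prod_type_right] using sum_snd_div_le_one p y
  · rw [if_pos rfl]
    exact div_pos (toReal_pos hz) (toReal_pos (map_apply_ne_zero _ hz))
  · simp [condEntropy_swap]
  · intro ε hε η hη
    obtain ⟨n, ⟨M, f, g, bad, h1, h2, h3⟩, hn⟩ :=
      ((exists_code_fst hb p hε hη).and (Filter.eventually_gt_atTop 0)).exists
    refine ⟨n, hn, M, 1, f, fun _ => 0, fun m _ => g m, bad, h1, ?_, h2, h3⟩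
    simp only [Nat.cast_one, Real.logb_one, zero_add]
    positivity

/-- If both source sequences can be recovered with small error probability, then zero distortion
is achievable. -/
theorem mem_region_of_lossless {b : ℝ} (hb : 1 < b) {p : PMF (Y₁ × Y₂)} {r₁ r₂ : ℝ}
    (hdec : ∀ ε > 0, ∀ η > 0, ∃ n : ℕ, 0 < n ∧ ∃ (M₁ M₂ : ℕ) (f₁ : (Fin n → Y₁) → Fin M₁)
      (f₂ : (Fin n → Y₂) → Fin M₂) (g : Fin M₁ → Fin M₂ → Fin n → Y₁ × Y₂)
      (bad : Finset (Fin n → Y₁ × Y₂)),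
      Real.logb b M₁ ≤ n * (r₁ + ε) ∧ Real.logb b M₂ ≤ n * (r₂ + ε) ∧
      (∀ s ∉ bad, g (f₁ fun j => (s j).1) (f₂ fun j => (s j).2) = s) ∧
      ∑ s ∈ bad, ∏ j, (p (s j)).toReal ≤ η) :
    (r₁, r₂, 0) ∈ region b (pairSource p) := by
  classical
  refine mem_region_of_decodable hb id (κ := fun v z => if v = z then 1 else 0)
    (fun _ _ => by positivity) (fun v => by simp) (fun z _ => by simp) (by simp) hdec

theorem sum_union_le {S : Type*} [DecidableEq S] {w : S → ℝ} (hw : ∀ s, 0 ≤ w s) {s t : Finset S}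
    {η : ℝ} (hs : ∑ x ∈ s, w x ≤ η / 2) (ht : ∑ x ∈ t, w x ≤ η / 2) : ∑ x ∈ s ∪ t, w x ≤ η := by
  have h := Finset.sum_union_inter (s₁ := s) (s₂ := t) (f := w)
  have := Finset.sum_nonneg fun x (_ : x ∈ s ∩ t) => hw x
  linarith

/-- Successive decoding: the second sequence is recovered on its own and then serves as side
information for the first. The union of the two error events is bounded by halving `η`. -/
theorem slepianWolf_mem_region {b : ℝ} (hb : 1 < b) (p : PMF (Y₁ × Y₂)) :
    (condEntropy b p, entropy b p - condEntropy b p, 0) ∈ region b (pairSource p) := by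
  classical
  refine mem_region_of_lossless hb fun ε hε η hη => ?_
  obtain ⟨n, ⟨⟨M₁, f₁, g₁, bad₁, h1, h2, h3⟩, M₂, f₂, g₂, bad₂, h1', h2', h3'⟩, hn⟩ :=
    (((exists_code_fst_given_snd hb p hε (half_pos hη)).and
      (exists_code_snd hb p hε (half_pos hη))).and (Filter.eventually_gt_atTop 0)).exists
  refine ⟨n, hn, M₁, M₂, f₁, f₂, fun m₁ m₂ j => (g₁ m₁ (g₂ m₂) j, g₂ m₂ j), bad₁ ∪ bad₂, h1, h1',
    fun s hs => ?_, sum_union_le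
      (fun s => Finset.prod_nonneg fun _ _ => ENNReal.toReal_nonneg) h3 h3'⟩
  rw [Finset.notMem_union] at hs
  simp only [h2' s hs.2, h2 s hs.1]

theorem slepianWolf_swap_mem_region {b : ℝ} (hb : 1 < b) (p : PMF (Y₁ × Y₂)) :
    (entropy b p - condEntropy b (p.map Prod.swap), condEntropy b (p.map Prod.swap), 0) ∈
      region b (pairSource p) := by
  classical
  refine mem_region_of_lossless hb fun ε hε η hη => ?_
  obtain ⟨n, ⟨⟨M₁, f₁, g₁, bad₁, h1, h2, h3⟩, M₂, f₂, g₂, bad₂, h1', h2', h3'⟩, hn⟩ :=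
    (((exists_code_fst hb p hε (half_pos hη)).and
      (exists_code_snd_given_fst hb p hε (half_pos hη))).and
        (Filter.eventually_gt_atTop 0)).exists
  refine ⟨n, hn, M₁, M₂, f₁, f₂, fun m₁ m₂ j => (g₁ m₁ j, g₂ m₂ (g₁ m₁) j), bad₁ ∪ bad₂, h1, h1',
    fun s hs => ?_, sum_union_le
      (fun s => Finset.prod_nonneg fun _ _ => ENNReal.toReal_nonneg) h3 h3'⟩
  rw [Finset.notMem_union] at hs
  simp only [h2 s hs.1, h2' s hs.2]

end

end CEO

end

theorem mainTheorem7 {Y₁ Y₂ : Type*} [Fintype Y₁] [Fintype Y₂] (b : ℝ) (hb : 1 < b)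
    (p : PMF (Y₁ × Y₂)) :
    CEO.region b (CEO.pairSource p) =
      {v : ℝ × ℝ × ℝ | ∃ R₁ R₂ D : ℝ, v = (R₁, R₂, D) ∧
        0 ≤ R₁ ∧ 0 ≤ R₂ ∧
        CEO.condEntropy b p - D ≤ R₁ ∧
        CEO.condEntropy b (p.map Prod.swap) - D ≤ R₂ ∧
        CEO.entropy b p - D ≤ R₁ + R₂ ∧
        0 ≤ D} := by
  refine Set.Subset.antisymm (fun v hv => ?_) ?_
  · exact ⟨v.1, v.2.1, v.2.2, rfl, CEO.region_subset_outerRegion hb p hv⟩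
  · rintro _ ⟨R₁, R₂, D, rfl, h1, h2, c1, c2, c3, h3⟩
    exact CEO.mem_of_extreme_points (CEO.convex_region hb p) isClosed_closure
      (fun v hv w hvw => CEO.region_upward hv hvw) (CEO.no_rate_mem_region hb p)
      (CEO.only_snd_mem_region hb p) (CEO.only_fst_mem_region hb p)
      (CEO.slepianWolf_mem_region hb p) (CEO.slepianWolf_swap_mem_region hb p)
      h1 h2 h3 c1 c2 c3
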